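/- Let $G=((S,E),(S_1,S_2,S_p),\delta)$ be a turn-based probabilistic game graph: $S$ is finite and partitioned into player-1, player-2 and probabilistic states, every $s\in S$ has a non-empty set $E(s)$ of successors, $\delta(s,\cdot)$ is a probability distribution on $S$ for $s\in S_p$, and then $E(s)=\{t:\delta(s,t)>0\}$. Let $r:S\to\mathbb R$, $0<\beta<1$ and $\varepsilon_{abs}>0$. Let $$\mathrm{val}(s)=\sup_{\sigma}\inf_{\tau}\mathbb E_s^{\sigma,\tau}\Big[(1-\beta)\sum_{i\ge 0}\beta^i r(s_i)\Big]$$ be the value of player 1 for the normalized discounted sum, where $\sigma,\tau$ range over all randomized history-dependent strategies of players 1 and 2. For a partition $R$ of $S$ into non-empty regions let $[s]_R$ be the region of $s$. For $x\in R$, $v:S\to\mathbb R$ and $u:R\to\mathbb R$ put $\hat g_x(t)=v(t)$ if $t\in x$ and $\hat g_x(t)=u([t]_R)$ otherwise, and for $s\in x$ let $\mathrm{MPre}_x(v,R,u)(s)$ be $\max_{t\in E(s)}\hat g_x(t)$, $\min_{t\in E(s)}\hat g_x(t)$ or $\sum_{t\in E(s)}\delta(s,t)\hat g_x(t)$, according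 to whether $s$ is in $S_1$, $S_2$ or $S_p$. For $h\in\{\max,\min\}$, a result of the exact global iteration for $(R,h)$ is a $u:R\to\mathbb R$ for which some $v:S\to\mathbb R$ satisfies $u(x)=h\{v(s): s\in x\}$ and $v(s)=(1-\beta)r(s)+\beta\,\mathrm{MPre}_x(v,R,u)(s)$ for all $x\in R$, $s\in x$. The algorithm MLA with $\varepsilon_{float}=0$ starts from an arbitrary partition $R_0$ and repeats the following for the current partition $R$: let $u^+$ and $u^-$ be results of the exact global iteration for $(R,\max)$ and $(R,\min)$; if $\max_{x\in R}|u^+(x)-u^-(x)|<\varepsilon_{abs}$, return $(R,u^+,u^-)$; otherwise replace $R$ by some partition that refines $R$ and splits every region $x$ with at least two states and $u^+(x)-u^-(x)>\varepsilon_{abs}$. Then, for every initial partition $R_0$, the algorithm has at least one possible output, and for every possible output $(R,u^+,u^-)$: 1. $u^-([s]_R)\le \mathrm{val}(s)\le u^+([s]_R)$ for all $s\in S$; 2. $u^+(x)-u^-(x)\le\varepsilon_{abs}$ for all $x\in R$. -/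

import Mathlib

open MeasureTheory ProbabilityTheory

noncomputable section

/-! ### Turn-based probabilistic game graphs -/

/-- Who chooses the successor of a state. -/
inductive Owner where
  | player1
  | player2
  | random

/-- A turn-based probabilistic game graph on a finite state space `S`. The field `owner` encodes
the partition `(S₁, S₂, Sₚ)` of `S`. Only the restriction of `prob` to the probabilistic states
plays a role. -/
structure GameGraph (S : Type*) where
  /-- the set `E(s)` of successors of `s` -/
  succ : S → Finset S
  /-- the kind of a state -/
  owner : S → Owner
  /-- the transition function; used at probabilistic states only -/
  prob : S → PMF S
  /-- every state has an outgoing edge -/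
  succ_nonempty : ∀ s, (succ s).Nonempty
  /-- at a probabilistic state the edges are the transitions of positive probability -/
  mem_succ_iff : ∀ s, owner s = Owner.random → ∀ t, t ∈ succ s ↔ prob s t ≠ 0

/-- A history `s₀, …, sₙ`: a non-empty finite sequence of states. -/
abbrev History (S : Type*) (n : ℕ) : Type _ := Finset.Iic n → S

/-- The last state of a history. -/
def History.last {S : Type*} {n : ℕ} (w : History S n) : S :=
  w ⟨n, Finset.mem_Iic.2 le_rfl⟩

namespace GameGraph

variable {S : Type*}

/-- A (randomized, history-dependent) strategy of the player `p`. Its value at a history matters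
only if the history ends in a state of `p`, and there it must prescribe available moves. -/
structure Strategy (G : GameGraph S) (p : Owner) where
  /-- the distribution chosen after each history -/
  move : (n : ℕ) → History S n → PMF S
  /-- only available moves are prescribed -/
  legal : ∀ n (w : History S n), G.owner w.last = p → ∀ t, move n w t ≠ 0 → t ∈ G.succ w.last

/-- The law of the next state after a history. -/
def stepLaw (G : GameGraph S) (σ : G.Strategy .player1) (τ : G.Strategy .player2) (n : ℕ)
    (w : History S n) : PMF S :=
  match G.owner w.last with
  | .player1 => σ.move n w
  | .player2 => τ.move n w
  | .random => G.prob w.last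

variable [Fintype S] [MeasurableSpace S] [DiscreteMeasurableSpace S]

/-- The law of the next state, as a kernel from histories to states. -/
def stepKernel (G : GameGraph S) (σ : G.Strategy .player1) (τ : G.Strategy .player2) (n : ℕ) :
    Kernel (History S n) S :=
  Kernel.ofFunOfCountable fun w => (G.stepLaw σ τ n w).toMeasure

instance (G : GameGraph S) (σ : G.Strategy .player1) (τ : G.Strategy .player2) (n : ℕ) :
    IsMarkovKernel (G.stepKernel σ τ n) :=
  ⟨fun w => inferInstanceAs (IsProbabilityMeasure (G.stepLaw σ τ n w).toMeasure)⟩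

/-- The law of the random play that starts in `s`, when the players follow `σ` and `τ`
(the Ionescu-Tulcea measure on infinite sequences of states). -/
def playLaw (G : GameGraph S) (σ : G.Strategy .player1) (τ : G.Strategy .player2) (s : S) :
    Measure (ℕ → S) :=
  Kernel.traj (X := fun _ => S) (G.stepKernel σ τ) 0 (fun _ => s)

/-- The value of player 1 at `s` for the quantitative objective `f`: the supremum over the
strategies of player 1 of the infimum over the strategies of player 2 of the expectation of `f`. -/
def value (G : GameGraph S) (f : (ℕ → S) → ℝ) (s : S) : ℝ :=
  ⨆ σ : G.Strategy .player1, ⨅ τ : G.Strategy .player2, ∫ ω, f ω ∂(G.playLaw σ τ s)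

end GameGraph

/-- The `β`-discounted sum of the rewards along a play. -/
def discountedSum {S : Type*} (β : ℝ) (r : S → ℝ) (ω : ℕ → S) : ℝ :=
  ∑' i : ℕ, β ^ i * r (ω i)

/-! ### Magnifying-lens abstraction -/

/-- The choice `h ∈ {max, min}`. -/
inductive Extremum where
  | max
  | min

/-- `h {v s | s ∈ x}` for a non-empty finite set `x`. -/
def Extremum.over {S : Type*} (h : Extremum) (x : Finset S) (hx : x.Nonempty) (v : S → ℝ) : ℝ :=
  match h with
  | .max => x.sup' hx v
  | .min => x.inf' hx v

section MLA

variable {S : Type*} [Fintype S] [DecidableEq S]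

/-- The partitions of the state space into non-empty regions. -/
abbrev StatePartition (S : Type*) [Fintype S] [DecidableEq S] : Type _ :=
  Finpartition (Finset.univ : Finset S)

/-- A valuation over the regions of a partition. -/
abbrev RegionVal (R : StatePartition S) : Type _ := R.parts → ℝ

/-- The region `[s]_R` of the state `s`. -/
def regionOf (R : StatePartition S) (s : S) : R.parts :=
  ⟨R.part s, R.part_mem.2 (Finset.mem_univ s)⟩

/-- The auxiliary valuation used in the region `x`: the local valuation `vx` inside `x`, and the
value of the region elsewhere. -/
def ghat (R : StatePartition S) (x : R.parts) (vx : x.1 → ℝ) (u : RegionVal R) (t : S) : ℝ :=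
  if ht : t ∈ x.1 then vx ⟨t, ht⟩ else u (regionOf R t)

/-- The magnified predecessor operator of the region `x`. -/
def magPre (G : GameGraph S) (R : StatePartition S) (x : R.parts) (vx : x.1 → ℝ)
    (u : RegionVal R) (s : x.1) : ℝ :=
  match G.owner s with
  | .player1 => (G.succ s).sup' (G.succ_nonempty s) (ghat R x vx u)
  | .player2 => (G.succ s).inf' (G.succ_nonempty s) (ghat R x vx u)
  | .random => ∑ t ∈ G.succ s, (G.prob s t).toReal * ghat R x vx u t

/-- `u` is the result of the exact global iteration for the partition `R` and `h ∈ {max, min}`: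
together with some valuation `v` of the states it solves the global constraints
`u x = h {v s | s ∈ x}` and, in each region `x`, the local fixpoint constraints. -/
def IsExactGlobal (G : GameGraph S) (β : ℝ) (r : S → ℝ) (h : Extremum) (R : StatePartition S)
    (u : RegionVal R) : Prop :=
  ∃ v : S → ℝ,
    (∀ x : R.parts, u x = h.over x.1 (R.nonempty_of_mem_parts x.2) v) ∧
    ∀ (x : R.parts) (s : x.1),
      v s = (1 - β) * r s + β * magPre G R x (fun t => v t) u s

/-- `R'` is a possible outcome of splitting the regions of `R`: it refines `R`, and every region
of imprecision greater than `ε` that has more than one state is split. -/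
def IsSplit (ε : ℝ) (R : StatePartition S) (up um : RegionVal R) (R' : StatePartition S) : Prop :=
  R' ≤ R ∧ ∀ x : R.parts, ε < up x - um x → 1 < x.1.card → x.1 ∉ R'.parts

/-- The configurations `(R, u⁺, u⁻)` which the main loop, started from the partition `R₀`, can
reach at its test, that is, after both global iterations. Exact global iterations do not depend on
the valuations that they start from, so these are not recorded. -/
inductive MLAReaches (G : GameGraph S) (β : ℝ) (r : S → ℝ) (ε : ℝ) (R₀ : StatePartition S) :
    (R : StatePartition S) → RegionVal R → RegionVal R → Prop
  | start (up um : RegionVal R₀) :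
      IsExactGlobal G β r .max R₀ up → IsExactGlobal G β r .min R₀ um →
      MLAReaches G β r ε R₀ R₀ up um
  | refine (R R' : StatePartition S) (up um : RegionVal R) (up' um' : RegionVal R') :
      MLAReaches G β r ε R₀ R up um → ε ≤ ‖up - um‖ → IsSplit ε R up um R' →
      IsExactGlobal G β r .max R' up' → IsExactGlobal G β r .min R' um' →
      MLAReaches G β r ε R₀ R' up' um'

/-- The algorithm, with exact global iterations and started from `R₀`, can return `(R, u⁺, u⁻)`:
this configuration is reached and the test `‖u⁺ - u⁻‖ ≥ ε` fails in it. -/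
def MLAReturns (G : GameGraph S) (β : ℝ) (r : S → ℝ) (ε : ℝ) (R₀ R : StatePartition S)
    (up um : RegionVal R) : Prop :=
  MLAReaches G β r ε R₀ R up um ∧ ¬ ε ≤ ‖up - um‖

end MLA

end

/-! Let `v` solve the local constraints for `min`. Every region value lies below `v` on its region,
so `ghat` is at most `v` everywhere, and monotonicity of `pre` makes `v` a subsolution of the
Bellman equation, `v ≤ (1 - β) r + β pre v`. If player 1 moves greedily for `v`, iterating this
inequality along the play bounds the expected payoff below by `v`, whatever player 2 does
(`le_value`). The case of `max` is dual, with a supersolution and a greedy player 2 (`value_le`).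
Neither determinacy nor the history of refinements enters. An output exists because exact global
solutions are fixed points of a `β`-contraction, and because splitting into singletons is always
allowed and closes the gap at once. The precision bound is the negated loop test. -/

section FiniteExpectation

variable {S : Type*} [Fintype S]

theorem PMF.sum_toReal_eq_one (p : PMF S) : ∑ t, (p t).toReal = 1 := by
  rw [← ENNReal.toReal_sum fun t _ => p.apply_ne_top t, ← tsum_fintype (L := .unconditional S),
    p.tsum_coe, ENNReal.toReal_one]

theorem PMF.sum_toReal_mul_le (p : PMF S) {f : S → ℝ} {c : ℝ} (h : ∀ t, p t ≠ 0 → f t ≤ c) :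
    ∑ t, (p t).toReal * f t ≤ c := by
  calc ∑ t, (p t).toReal * f t ≤ ∑ t, (p t).toReal * c := by
        refine Finset.sum_le_sum fun t _ => ?_
        by_cases ht : p t = 0
        · simp [ht]
        · exact mul_le_mul_of_nonneg_left (h t ht) ENNReal.toReal_nonneg
    _ = c := by rw [← Finset.sum_mul, p.sum_toReal_eq_one, one_mul]

theorem PMF.le_sum_toReal_mul (p : PMF S) {f : S → ℝ} {c : ℝ} (h : ∀ t, p t ≠ 0 → c ≤ f t) :
    c ≤ ∑ t, (p t).toReal * f t := by
  have := p.sum_toReal_mul_le (f := fun t => -f t) (c := -c) fun t ht => neg_le_neg (h t ht)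
  simp only [mul_neg, Finset.sum_neg_distrib] at this
  linarith

theorem PMF.sum_toReal_pure_mul [DecidableEq S] (a : S) (f : S → ℝ) :
    ∑ t, ((PMF.pure a : PMF S) t).toReal * f t = f a := by
  rw [Finset.sum_eq_single a]
  · simp
  · intro t _ ht
    simp [PMF.pure_apply_of_ne _ _ ht]
  · simp

end FiniteExpectation

/-! ### The one-step operator and greedy positional strategies -/

namespace GameGraph

/-- The one-step optimality operator of the game. -/
noncomputable def pre {S : Type*} (G : GameGraph S) (f : S → ℝ) (s : S) : ℝ :=
  match G.owner s with
  | .player1 => (G.succ s).sup' (G.succ_nonempty s) f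
  | .player2 => (G.succ s).inf' (G.succ_nonempty s) f
  | .random => ∑ t ∈ G.succ s, (G.prob s t).toReal * f t

/-- The strategy that always moves from a state `s` to its successor `f s`. -/
noncomputable def positional {S : Type*} (G : GameGraph S) (p : Owner) (f : S → S)
    (hf : ∀ s, f s ∈ G.succ s) : G.Strategy p where
  move _ w := PMF.pure (f w.last)
  legal _ w _ t ht := by
    have : t = f w.last := by simpa using (PMF.mem_support_iff _ _).2 ht
    exact this ▸ hf _

instance {S : Type*} (G : GameGraph S) (p : Owner) : Nonempty (G.Strategy p) :=
  ⟨G.positional p (fun s => (G.succ_nonempty s).choose) fun s => (G.succ_nonempty s).choose_spec⟩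

variable {S : Type*} [Fintype S] (G : GameGraph S)

theorem sum_succ_prob {s : S} (hs : G.owner s = .random) (f : S → ℝ) :
    ∑ t ∈ G.succ s, (G.prob s t).toReal * f t = ∑ t, (G.prob s t).toReal * f t := by
  refine Finset.sum_subset (Finset.subset_univ _) fun t _ ht => ?_
  rw [G.mem_succ_iff s hs, not_not] at ht
  simp [ht]

/-- The additive slack serves twice: `c = 0` gives monotonicity, and `c` equal to a sup distance
gives nonexpansiveness. -/
theorem pre_le_add {f g : S → ℝ} {c : ℝ} (h : ∀ t, f t ≤ g t + c) (s : S) :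
    G.pre f s ≤ G.pre g s + c := by
  cases hs : G.owner s <;> simp only [pre, hs]
  · exact Finset.sup'_le _ _ fun t ht =>
      (h t).trans (add_le_add_left (Finset.le_sup' g ht) c)
  · rw [← sub_le_iff_le_add]
    exact Finset.le_inf' _ _ fun t ht =>
      sub_le_iff_le_add.2 ((Finset.inf'_le f ht).trans (h t))
  · rw [G.sum_succ_prob hs, G.sum_succ_prob hs]
    calc ∑ t, (G.prob s t).toReal * f t ≤ ∑ t, (G.prob s t).toReal * (g t + c) :=
          Finset.sum_le_sum fun t _ => mul_le_mul_of_nonneg_left (h t) ENNReal.toReal_nonneg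
      _ = _ := by
          simp only [mul_add, Finset.sum_add_distrib, ← Finset.sum_mul, PMF.sum_toReal_eq_one,
            one_mul]

theorem pre_mono {f g : S → ℝ} (h : ∀ t, f t ≤ g t) (s : S) : G.pre f s ≤ G.pre g s := by
  simpa using G.pre_le_add (c := 0) (by simpa using h) s

/-- A positional choice of maximizing successors works against all `τ` at once: legal moves of
player 2 average to at least the minimum over successors. -/
theorem exists_player1_pre_le [DecidableEq S] (v : S → ℝ) :
    ∃ σ : G.Strategy .player1, ∀ (τ : G.Strategy .player2) (n : ℕ) (w : History S n),
      G.pre v w.last ≤ ∑ t, (G.stepLaw σ τ n w t).toReal * v t := by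
  choose f hf hfv using fun s => Finset.exists_mem_eq_sup' (G.succ_nonempty s) v
  refine ⟨G.positional _ f hf, fun τ n w => ?_⟩
  cases hs : G.owner w.last <;> simp only [pre, stepLaw, hs]
  · rw [hfv]
    exact (PMF.sum_toReal_pure_mul _ v).ge
  · exact PMF.le_sum_toReal_mul _ fun t ht => Finset.inf'_le v (τ.legal n w hs t ht)
  · exact (G.sum_succ_prob hs v).le

theorem exists_player2_le_pre [DecidableEq S] (v : S → ℝ) :
    ∃ τ : G.Strategy .player2, ∀ (σ : G.Strategy .player1) (n : ℕ) (w : History S n),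
      ∑ t, (G.stepLaw σ τ n w t).toReal * v t ≤ G.pre v w.last := by
  choose f hf hfv using fun s => Finset.exists_mem_eq_inf' (G.succ_nonempty s) v
  refine ⟨G.positional _ f hf, fun σ n w => ?_⟩
  cases hs : G.owner w.last <;> simp only [pre, stepLaw, hs]
  · exact PMF.sum_toReal_mul_le _ fun t ht => Finset.le_sup' v (σ.legal n w hs t ht)
  · rw [hfv]
    exact (PMF.sum_toReal_pure_mul _ v).le
  · exact (G.sum_succ_prob hs v).ge

/-! ### Expectations along the random play -/

variable [MeasurableSpace S] [DiscreteMeasurableSpace S]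
  (σ : G.Strategy .player1) (τ : G.Strategy .player2) (s : S)

instance : IsProbabilityMeasure (G.playLaw σ τ s) := by
  unfold playLaw
  infer_instance

theorem integrable_comp_frestrictLe (n : ℕ) (f : History S n → ℝ) :
    Integrable (fun ω => f (Preorder.frestrictLe n ω)) (G.playLaw σ τ s) := by
  have : IsProbabilityMeasure ((G.playLaw σ τ s).map (Preorder.frestrictLe n)) :=
    Measure.isProbabilityMeasure_map (by fun_prop)
  exact (Integrable.of_finite (f := f)).comp_measurable (Preorder.measurable_frestrictLe n)

theorem integrable_comp_eval (n : ℕ) (f : S → ℝ) :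
    Integrable (fun ω => f (ω n)) (G.playLaw σ τ s) :=
  G.integrable_comp_frestrictLe σ τ s n fun w => f w.last

theorem integral_eval_zero (f : S → ℝ) : ∫ ω, f (ω 0) ∂G.playLaw σ τ s = f s := by
  have h := Kernel.traj_map_frestrictLe_apply (X := fun _ => S) (κ := G.stepKernel σ τ) 0 0
    (fun _ => s)
  rw [Kernel.partialTraj_self, Kernel.id_apply] at h
  have h' := integral_map (μ := G.playLaw σ τ s) (φ := Preorder.frestrictLe 0) (by fun_prop)
    (f := fun w : History S 0 => f w.last) AEStronglyMeasurable.of_discrete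
  rw [playLaw] at h'
  rw [h, integral_dirac] at h'
  exact h'.symm

/-- The tower property: condition on the first `n` steps. -/
theorem integral_eval_succ (n : ℕ) (f : S → ℝ) :
    ∫ ω, f (ω (n + 1)) ∂G.playLaw σ τ s =
      ∫ ω, ∑ t, (G.stepLaw σ τ n (Preorder.frestrictLe n ω) t).toReal * f t
        ∂G.playLaw σ τ s := by
  have hstep : ∀ w : History S n,
      ∫ ω, f (ω (n + 1)) ∂(Kernel.traj (X := fun _ => S) (G.stepKernel σ τ) n w) =
        ∑ t, (G.stepLaw σ τ n w t).toReal * f t := by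
    intro w
    have h := DFunLike.congr_fun
      (Kernel.map_traj_succ_self (X := fun _ => S) (κ := G.stepKernel σ τ) (a := n)) w
    rw [Kernel.map_apply _ (by fun_prop)] at h
    have h' := integral_map (μ := Kernel.traj (X := fun _ => S) (G.stepKernel σ τ) n w)
      (φ := fun ω => ω (n + 1)) (measurable_pi_apply (n + 1)).aemeasurable (f := f) AEStronglyMeasurable.of_discrete
    rw [← h', h]
    exact PMF.integral_eq_sum _ _
  have h := Kernel.integral_traj_partialTraj (X := fun _ => S) (κ := G.stepKernel σ τ)
    (Nat.zero_le n) (x₀ := fun _ => s) (f := fun ω => f (ω (n + 1)))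
    (G.integrable_comp_eval σ τ s (n + 1) f)
  simp only [hstep] at h
  rw [playLaw, ← h, ← Kernel.traj_map_frestrictLe_apply,
    integral_map (by fun_prop) AEStronglyMeasurable.of_discrete]

/-! ### Sub- and supersolutions bound the discounted value -/

variable {β : ℝ} (hβ0 : 0 < β) (hβ1 : β < 1)
include hβ0 hβ1

theorem hasSum_integral_discountedSum (r : S → ℝ) :
    HasSum (fun i => β ^ i * ∫ ω, r (ω i) ∂G.playLaw σ τ s)
      (∫ ω, discountedSum β r ω ∂G.playLaw σ τ s) := by
  have h := hasSum_integral_of_summable_integral_norm (μ := G.playLaw σ τ s)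
    (F := fun i ω => β ^ i * r (ω i))
    (fun i => (G.integrable_comp_eval σ τ s i r).const_mul _) ?_
  · simp only [integral_const_mul] at h
    exact h
  · refine Summable.of_nonneg_of_le (fun i => integral_nonneg fun ω => norm_nonneg _)
      (fun i => ?_) ((summable_geometric_of_lt_one hβ0.le hβ1).mul_right ‖r‖)
    calc ∫ ω, ‖β ^ i * r (ω i)‖ ∂G.playLaw σ τ s
        ≤ ∫ _, β ^ i * ‖r‖ ∂G.playLaw σ τ s := by
          refine integral_mono
            (G.integrable_comp_eval σ τ s i r |>.const_mul _).norm (integrable_const _) fun ω => ?_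
          rw [norm_mul, norm_pow, Real.norm_of_nonneg hβ0.le]
          exact mul_le_mul_of_nonneg_left (norm_le_pi_norm r _) (by positivity)
      _ = β ^ i * ‖r‖ := by simp

theorem le_integral_discountedSum {r v : S → ℝ}
    (h : ∀ n (w : History S n),
      v w.last ≤ (1 - β) * r w.last + β * ∑ t, (G.stepLaw σ τ n w t).toReal * v t) :
    v s ≤ ∫ ω, (1 - β) * discountedSum β r ω ∂G.playLaw σ τ s := by
  set a : ℕ → ℝ := fun n => ∫ ω, v (ω n) ∂G.playLaw σ τ s with ha
  set b : ℕ → ℝ := fun n => ∫ ω, r (ω n) ∂G.playLaw σ τ s with hb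
  have hstep : ∀ n, a n ≤ (1 - β) * b n + β * a (n + 1) := by
    intro n
    have hr := (G.integrable_comp_eval σ τ s n r).const_mul (1 - β)
    have hv := (G.integrable_comp_frestrictLe σ τ s n fun w =>
      ∑ t, (G.stepLaw σ τ n w t).toReal * v t).const_mul β
    simp only [ha, hb]
    rw [G.integral_eval_succ, ← integral_const_mul, ← integral_const_mul, ← integral_add hr hv]
    exact integral_mono (G.integrable_comp_eval σ τ s n v) (hr.add hv)
      fun ω => h n (Preorder.frestrictLe n ω)
  have hsum : ∀ n, v s ≤ (1 - β) * ∑ i ∈ Finset.range n, β ^ i * b i + β ^ n * a n := by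
    intro n
    induction n with
    | zero => simp [ha, G.integral_eval_zero]
    | succ n ih =>
      have := mul_le_mul_of_nonneg_left (hstep n) (pow_nonneg hβ0.le n)
      rw [Finset.sum_range_succ, pow_succ]
      linarith
  rw [integral_const_mul]
  -- The remainder `β ^ n * a n` vanishes as the general term of the convergent series with `v` as
  -- reward.
  have hlim := ((G.hasSum_integral_discountedSum σ τ s hβ0 hβ1 r).tendsto_sum_nat.const_mul
    (1 - β)).add (G.hasSum_integral_discountedSum σ τ s hβ0 hβ1 v).summable.tendsto_atTop_zero
  rw [add_zero] at hlim
  exact ge_of_tendsto' hlim hsum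

theorem integral_discountedSum_le {r v : S → ℝ}
    (h : ∀ n (w : History S n),
      (1 - β) * r w.last + β * ∑ t, (G.stepLaw σ τ n w t).toReal * v t ≤ v w.last) :
    ∫ ω, (1 - β) * discountedSum β r ω ∂G.playLaw σ τ s ≤ v s := by
  have := G.le_integral_discountedSum σ τ s hβ0 hβ1 (r := -r) (v := -v) fun n w => by
    simp only [Pi.neg_apply, mul_neg, Finset.sum_neg_distrib]
    linarith [h n w]
  have hneg : ∀ ω, discountedSum β (-r) ω = -discountedSum β r ω := fun ω => by
    simp [discountedSum, tsum_neg]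
  simp only [hneg, mul_neg, integral_neg, Pi.neg_apply] at this
  linarith

/-- The constants `-‖r‖` and `‖r‖` are a sub- and a supersolution. The bound, uniform in the
strategies, makes the real suprema and infima in `value` genuine. -/
theorem abs_integral_discountedSum_le (r : S → ℝ) :
    |∫ ω, (1 - β) * discountedSum β r ω ∂G.playLaw σ τ s| ≤ ‖r‖ := by
  have hr : ∀ t, |r t| ≤ ‖r‖ := fun t => norm_le_pi_norm r t
  refine abs_le.2 ⟨?_, ?_⟩
  · refine G.le_integral_discountedSum σ τ s hβ0 hβ1 (v := fun _ => -‖r‖) fun n w => ?_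
    rw [← Finset.sum_mul, PMF.sum_toReal_eq_one]
    nlinarith [(abs_le.1 (hr w.last)).1]
  · refine G.integral_discountedSum_le σ τ s hβ0 hβ1 (v := fun _ => ‖r‖) fun n w => ?_
    rw [← Finset.sum_mul, PMF.sum_toReal_eq_one]
    nlinarith [(abs_le.1 (hr w.last)).2]

omit σ τ

theorem le_value [DecidableEq S] {r v : S → ℝ}
    (h : ∀ s, v s ≤ (1 - β) * r s + β * G.pre v s) :
    v s ≤ G.value (fun ω => (1 - β) * discountedSum β r ω) s := by
  obtain ⟨σ, hσ⟩ := G.exists_player1_pre_le v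
  have hbdd : ∀ σ, BddBelow (Set.range fun τ : G.Strategy .player2 =>
      ∫ ω, (1 - β) * discountedSum β r ω ∂G.playLaw σ τ s) := fun σ => ⟨-‖r‖, by
    rintro _ ⟨τ, rfl⟩
    exact (abs_le.1 (G.abs_integral_discountedSum_le σ τ s hβ0 hβ1 r)).1⟩
  refine le_ciSup_of_le ⟨‖r‖, ?_⟩ σ (le_ciInf fun τ => ?_)
  · rintro _ ⟨σ, rfl⟩
    exact ciInf_le_of_le (hbdd σ) (Classical.arbitrary _)
      (abs_le.1 (G.abs_integral_discountedSum_le σ _ s hβ0 hβ1 r)).2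
  · refine G.le_integral_discountedSum σ τ s hβ0 hβ1 fun n w => (h _).trans ?_
    gcongr
    exact hσ τ n w

theorem value_le [DecidableEq S] {r v : S → ℝ}
    (h : ∀ s, (1 - β) * r s + β * G.pre v s ≤ v s) :
    G.value (fun ω => (1 - β) * discountedSum β r ω) s ≤ v s := by
  obtain ⟨τ, hτ⟩ := G.exists_player2_le_pre v
  refine ciSup_le fun σ => ciInf_le_of_le ⟨-‖r‖, ?_⟩ τ ?_
  · rintro _ ⟨τ, rfl⟩
    exact (abs_le.1 (G.abs_integral_discountedSum_le σ τ s hβ0 hβ1 r)).1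
  · refine G.integral_discountedSum_le σ τ s hβ0 hβ1 fun n w => le_trans ?_ (h _)
    gcongr
    exact hτ σ n w

end GameGraph

/-! ### Exact global iteration and existence of an output -/

theorem Extremum.over_le_add {S : Type*} (h : Extremum) (x : Finset S) (hx : x.Nonempty)
    {v w : S → ℝ} {c : ℝ} (hvw : ∀ t, v t ≤ w t + c) : h.over x hx v ≤ h.over x hx w + c := by
  cases h <;> simp only [Extremum.over]
  · exact Finset.sup'_le _ _ fun t ht =>
      (hvw t).trans (add_le_add_left (Finset.le_sup' w ht) c)
  · rw [← sub_le_iff_le_add]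
    exact Finset.le_inf' _ _ fun t ht =>
      sub_le_iff_le_add.2 ((Finset.inf'_le v ht).trans (hvw t))

section ExactGlobal

variable {S : Type*} [Fintype S] [DecidableEq S]

theorem mem_regionOf (R : StatePartition S) (s : S) : s ∈ (regionOf R s).1 :=
  R.mem_part (Finset.mem_univ s)

theorem regionOf_eq_of_mem {R : StatePartition S} {x : R.parts} {s : S} (hs : s ∈ x.1) :
    regionOf R s = x :=
  Subtype.ext (R.part_eq_of_mem x.2 hs)

theorem magPre_eq_pre (G : GameGraph S) (R : StatePartition S) (x : R.parts) (vx : x.1 → ℝ)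
    (u : RegionVal R) (s : x.1) : magPre G R x vx u s = G.pre (ghat R x vx u) s := rfl

/-- The valuation of the regions of `R` induced by a valuation of the states. -/
noncomputable def Extremum.lift (h : Extremum) (R : StatePartition S) (v : S → ℝ) :
    RegionVal R :=
  fun x => h.over x.1 (R.nonempty_of_mem_parts x.2) v

/-- The simultaneous update of all states whose fixed points are the exact global solutions. -/
noncomputable def globalUpdate (G : GameGraph S) (β : ℝ) (r : S → ℝ) (h : Extremum)
    (R : StatePartition S) (v : S → ℝ) (s : S) : ℝ :=
  (1 - β) * r s + β * G.pre (ghat R (regionOf R s) (fun t => v t) (h.lift R v)) s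

theorem ghat_le_add (h : Extremum) (R : StatePartition S) (x : R.parts) {v w : S → ℝ} {c : ℝ}
    (hvw : ∀ t, v t ≤ w t + c) (t : S) :
    ghat R x (fun t => v t) (h.lift R v) t ≤ ghat R x (fun t => w t) (h.lift R w) t + c := by
  unfold ghat
  split_ifs
  · exact hvw t
  · exact h.over_le_add _ _ hvw

theorem globalUpdate_le_add (G : GameGraph S) {β : ℝ} (hβ0 : 0 < β) (r : S → ℝ) (h : Extremum)
    (R : StatePartition S) {v w : S → ℝ} {c : ℝ} (hvw : ∀ t, v t ≤ w t + c) (s : S) :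
    globalUpdate G β r h R v s ≤ globalUpdate G β r h R w s + β * c := by
  have := mul_le_mul_of_nonneg_left
    (G.pre_le_add (ghat_le_add h R (regionOf R s) hvw) s) hβ0.le
  simp only [globalUpdate]
  linarith

theorem contractingWith_globalUpdate (G : GameGraph S) {β : ℝ} (hβ0 : 0 < β) (hβ1 : β < 1)
    (r : S → ℝ) (h : Extremum) (R : StatePartition S) :
    ContractingWith ⟨β, hβ0.le⟩ (globalUpdate G β r h R) := by
  refine ⟨hβ1, LipschitzWith.of_dist_le_mul fun v w => ?_⟩
  -- With `c = dist v w`, the one-sided estimate in both orders yields the Lipschitz bound.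
  have hle : ∀ (v w : S → ℝ) t, v t ≤ w t + dist v w := fun v w t => by
    linarith [(abs_le.1 (Real.dist_eq (v t) (w t) ▸ dist_le_pi_dist v w t)).2]
  refine (dist_pi_le_iff (mul_nonneg hβ0.le dist_nonneg)).2 fun s => ?_
  have h1 := globalUpdate_le_add G hβ0 r h R (hle v w) s
  have h2 := globalUpdate_le_add G hβ0 r h R (hle w v) s
  rw [dist_comm w v] at h2
  rw [Real.dist_eq, abs_le]
  change -(β * dist v w) ≤ _ ∧ _ ≤ β * dist v w
  constructor <;> linarith

theorem exists_isExactGlobal (G : GameGraph S) {β : ℝ} (hβ0 : 0 < β) (hβ1 : β < 1)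
    (r : S → ℝ) (h : Extremum) (R : StatePartition S) : ∃ u, IsExactGlobal G β r h R u := by
  have hc := contractingWith_globalUpdate G hβ0 hβ1 r h R
  refine ⟨h.lift R hc.fixedPoint, hc.fixedPoint, fun _ => rfl, fun x s => ?_⟩
  have hv := congrFun hc.fixedPoint_isFixedPt s
  rw [globalUpdate, regionOf_eq_of_mem s.2] at hv
  exact hv.symm

/-- Regions of `⊥` are singletons, over which `max` and `min` agree. -/
theorem isExactGlobal_bot_congr {G : GameGraph S} {β : ℝ} {r : S → ℝ} {h : Extremum}
    (h' : Extremum) {u : RegionVal (⊥ : StatePartition S)} (hu : IsExactGlobal G β r h ⊥ u) :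
    IsExactGlobal G β r h' ⊥ u := by
  obtain ⟨v, huv, hv⟩ := hu
  refine ⟨v, fun x => (huv x).trans ?_, hv⟩
  obtain ⟨s, -, hs⟩ := Finpartition.mem_bot_iff.1 x.2
  cases h <;> cases h' <;> simp [Extremum.over, ← hs]

theorem isSplit_bot (ε : ℝ) (R : StatePartition S) (up um : RegionVal R) :
    IsSplit ε R up um ⊥ := by
  refine ⟨bot_le, fun x _ hx hmem => ?_⟩
  obtain ⟨s, -, hs⟩ := Finpartition.mem_bot_iff.1 hmem
  simp [← hs] at hx

theorem exists_mlaReturns (G : GameGraph S) {β : ℝ} (hβ0 : 0 < β) (hβ1 : β < 1) (r : S → ℝ)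
    {ε : ℝ} (hε : 0 < ε) (R₀ : StatePartition S) :
    ∃ (R : StatePartition S) (up um : RegionVal R), MLAReturns G β r ε R₀ R up um := by
  obtain ⟨up, hup⟩ := exists_isExactGlobal G hβ0 hβ1 r .max R₀
  obtain ⟨um, hum⟩ := exists_isExactGlobal G hβ0 hβ1 r .min R₀
  by_cases hlt : ε ≤ ‖up - um‖
  -- One refinement to `⊥` suffices: the same `u` serves both extrema, so the gap is `0 < ε`.
  · obtain ⟨u, hu⟩ := exists_isExactGlobal G hβ0 hβ1 r .max (⊥ : StatePartition S)
    exact ⟨⊥, u, u, .refine R₀ ⊥ up um u u (.start up um hup hum) hlt (isSplit_bot ε R₀ up um) hu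
      (isExactGlobal_bot_congr .min hu), by simpa using hε⟩
  · exact ⟨R₀, up, um, .start up um hup hum, hlt⟩

theorem MLAReaches.isExactGlobal {G : GameGraph S} {β : ℝ} {r : S → ℝ} {ε : ℝ}
    {R₀ R : StatePartition S} {up um : RegionVal R} (h : MLAReaches G β r ε R₀ R up um) :
    IsExactGlobal G β r .max R up ∧ IsExactGlobal G β r .min R um := by
  cases h with
  | start _ _ hup hum => exact ⟨hup, hum⟩
  | refine _ _ _ _ _ _ _ _ _ hup hum => exact ⟨hup, hum⟩

/-! ### Soundness of the region bounds -/

variable [MeasurableSpace S] [DiscreteMeasurableSpace S]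

theorem IsExactGlobal.le_value {G : GameGraph S} {β : ℝ} (hβ0 : 0 < β) (hβ1 : β < 1)
    {r : S → ℝ} {R : StatePartition S} {u : RegionVal R} (hu : IsExactGlobal G β r .min R u)
    (s : S) : u (regionOf R s) ≤ G.value (fun ω => (1 - β) * discountedSum β r ω) s := by
  obtain ⟨v, huv, hv⟩ := hu
  have hle : ∀ t, u (regionOf R t) ≤ v t := fun t => by
    rw [huv]
    exact Finset.inf'_le v (mem_regionOf R t)
  refine (hle s).trans (G.le_value s hβ0 hβ1 fun t => ?_)
  rw [hv (regionOf R t) ⟨t, mem_regionOf R t⟩, magPre_eq_pre]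
  gcongr
  -- Inside the region `ghat` is `v`; outside it is a region minimum, hence below `v`.
  refine G.pre_mono (fun t' => ?_) t
  unfold ghat
  split_ifs
  exacts [le_rfl, hle t']

theorem IsExactGlobal.value_le {G : GameGraph S} {β : ℝ} (hβ0 : 0 < β) (hβ1 : β < 1)
    {r : S → ℝ} {R : StatePartition S} {u : RegionVal R} (hu : IsExactGlobal G β r .max R u)
    (s : S) : G.value (fun ω => (1 - β) * discountedSum β r ω) s ≤ u (regionOf R s) := by
  obtain ⟨v, huv, hv⟩ := hu
  have hle : ∀ t, v t ≤ u (regionOf R t) := fun t => by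
    rw [huv]
    exact Finset.le_sup' v (mem_regionOf R t)
  refine (G.value_le s hβ0 hβ1 fun t => ?_).trans (hle s)
  rw [hv (regionOf R t) ⟨t, mem_regionOf R t⟩, magPre_eq_pre]
  gcongr
  refine G.pre_mono (fun t' => ?_) t
  unfold ghat
  split_ifs
  exacts [le_rfl, hle t']

end ExactGlobal

theorem theorem4 {S : Type*} [Fintype S] [DecidableEq S] [MeasurableSpace S]
    [DiscreteMeasurableSpace S] (G : GameGraph S) (β : ℝ) (hβ0 : 0 < β) (hβ1 : β < 1)
    (r : S → ℝ) (ε : ℝ) (hε : 0 < ε) (R₀ : StatePartition S) :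
    (∃ (R : StatePartition S) (up um : RegionVal R), MLAReturns G β r ε R₀ R up um) ∧
    ∀ (R : StatePartition S) (up um : RegionVal R), MLAReturns G β r ε R₀ R up um →
      (∀ s : S,
        um (regionOf R s) ≤ G.value (fun ω => (1 - β) * discountedSum β r ω) s ∧
        G.value (fun ω => (1 - β) * discountedSum β r ω) s ≤ up (regionOf R s)) ∧
      ∀ x : R.parts, up x - um x ≤ ε := by
  refine ⟨exists_mlaReturns G hβ0 hβ1 r hε R₀, fun R up um ⟨hreach, hlt⟩ =>
    ⟨fun s => ⟨hreach.isExactGlobal.2.le_value hβ0 hβ1 s,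
      hreach.isExactGlobal.1.value_le hβ0 hβ1 s⟩, fun x => ?_⟩⟩
  exact ((le_abs_self _).trans (norm_le_pi_norm (up - um) x)).trans (not_le.1 hlt).le
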